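/- For a domain $\Omega\subset\mathbb C^n$ let $$k_\Omega(x,v)=\inf\{\,r>0:\ \exists\,\varphi:\Delta\to\Omega\text{ holomorphic},\ \varphi(0)=x,\ r\varphi'(0)=v\,\}$$ be the Kobayashi–Royden metric, where $\Delta$ is the open unit disc in $\mathbb C$, and let $$d_\Omega(x,y)=\inf_\gamma\int_0^1 k_\Omega(\gamma(t),\gamma'(t))\,dt$$ be the (integrated) Kobayashi distance, the infimum being over all $C^1$ curves $\gamma:[0,1]\to\Omega$ from $x$ to $y$. Write $\mathbb B^n$ for the open Euclidean unit ball of $\mathbb C^n$. **Proposition.** Let $\Omega\subset\mathbb C^n$ be a domain (in particular, $\Omega$ may be any bounded strongly pseudoconvex domain with $C^{2,\epsilon}$ boundary), and let $h:\Delta\to\Omega$ be an isometric holomorphic disc (for instance a Lempert–Burns–Krantz disc), that is, a holomorphic map with $d_\Omega(h(a),h(b))=d_\Delta(a,b)$ for all $a,b\in\Delta$. Let $f:\Omega\to\mathbb B^n$ be a continuous map that is isometric for the Kobayashi distances, that is, $d_{\mathbb B^n}(f(x),f(y))=d_\Omega(x,y)$ for all $x,y\in\Omega$. Then the composition $f\circ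 h:\Delta\to\mathbb B^n$ is holomorphic or conjugate-holomorphic (i.e. $\overline{f\circ h}$ is holomorphic) on $\Delta$. -/

import Mathlib

open Set MeasureTheory
open scoped ENNReal ComplexConjugate

/-- The Kobayashi–Royden infinitesimal metric `k_Ω(x, v)` of a set `Ω` in a complex normed space:
the infimum of all `r > 0` for which there is a holomorphic map `φ` from the open unit disc into
`Ω` with `φ 0 = x` and `φ'(0) = v / r`. -/
noncomputable def kobayashiRoyden {E : Type*} [NormedAddCommGroup E] [NormedSpace ℂ E]
    (Ω : Set E) (x v : E) : ℝ≥0∞ :=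
  ⨅ (φ : ℂ → E) (_ : DifferentiableOn ℂ φ (Metric.ball 0 1))
    (_ : MapsTo φ (Metric.ball 0 1) Ω) (_ : φ 0 = x)
    (r : ℝ) (_ : 0 < r) (_ : (r : ℂ) • deriv φ 0 = v), ENNReal.ofReal r

/-- The (integrated) Kobayashi distance `d_Ω(x, y)`: the infimum of the Kobayashi–Royden lengths
of the `C¹` curves `γ : [0, 1] → Ω` from `x` to `y`. -/
noncomputable def kobayashiDist {E : Type*} [NormedAddCommGroup E] [NormedSpace ℂ E]
    (Ω : Set E) (x y : E) : ℝ≥0∞ :=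
  ⨅ (γ : ℝ → E) (_ : ContDiffOn ℝ 1 γ (Icc 0 1)) (_ : MapsTo γ (Icc 0 1) Ω)
    (_ : γ 0 = x) (_ : γ 1 = y),
    ∫⁻ t in Icc (0 : ℝ) 1, kobayashiRoyden Ω (γ t) (derivWithin γ (Icc 0 1) t)

/-- `f` maps `U` into `V` and preserves the Kobayashi distances of `U` and `V`. -/
def PreservesKobayashiDist {E F : Type*} [NormedAddCommGroup E] [NormedSpace ℂ E]
    [NormedAddCommGroup F] [NormedSpace ℂ F] (f : E → F) (U : Set E) (V : Set F) : Prop :=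
  MapsTo f U V ∧ ∀ x ∈ U, ∀ y ∈ U, kobayashiDist V (f x) (f y) = kobayashiDist U x y

/-- An isometric holomorphic disc in `Ω`: a holomorphic map `h` from the open unit disc into `Ω`
that preserves the Kobayashi distances. -/
def IsIsometricHolomorphicDisc {E : Type*} [NormedAddCommGroup E] [NormedSpace ℂ E]
    (h : ℂ → E) (Ω : Set E) : Prop :=
  DifferentiableOn ℂ h (Metric.ball 0 1) ∧ PreservesKobayashiDist h (Metric.ball 0 1) Ω

/-- `g` is conjugate-holomorphic on `U`: the complex conjugate of every component of `g` is
holomorphic on `U`. -/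
def ConjHolomorphicOn {n : ℕ} (g : ℂ → EuclideanSpace ℂ (Fin n)) (U : Set ℂ) : Prop :=
  ∀ i, DifferentiableOn ℂ (fun z => conj (g z i)) U

/-!
The composition `g = f ∘ h` preserves the Kobayashi distances of the disc and of the ball, and
every such `g` is `z ↦ z • e` or `z ↦ conj z • e`, with a unit vector `e`, followed by an
automorphism of the ball.

The Kobayashi distance of the ball is computed explicitly, for the unit ball of any complex inner
product space, so that one formula covers the disc and `𝔹ⁿ`. The ball has the holomorphic
involutions `ballInvolution a`, exchanging `a` and `0`, and holomorphic maps do not increase the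
distance (`kobayashiDist_map_le`), so these involutions are isometries. Hence it suffices to find
the distance from `0` to `y`, which is `artanh ‖y‖`: the upper bound comes from the segment
`t ↦ t • y`, the lower bound from projecting a curve to `(-1, 1)` by `x ↦ Re ⟪y / ‖y‖, x⟫` and
using the Schwarz–Pick lemma (`le_kobayashiRoyden_ball`). With the identity
`1 - ‖ballInvolution x y‖² = (1 - ‖x‖²)(1 - ‖y‖²) / |1 - ⟪x, y⟫|²` the distance of `x` and `y`
determines, and is determined by, the right-hand side.

Composing `g` with the involution of `g 0` gives an isometry `G` with `G 0 = 0`. The formula then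
says `‖G z‖ = ‖z‖` and `|1 - ⟪G z, G w⟫| = |1 - conj z * w|`. For `w = -z` the equality case of
the Cauchy–Schwarz inequality forces `G (-z) = -G z`; using the relation for `w` and for `-w` gives
`|⟪G z, G w⟫| = |z| |w|` and `Re ⟪G z, G w⟫ = Re (conj z * w)`. By the first equality all values
of `G` lie on one complex line `ℂ e`, and by the second `G` is the restriction of a real-linear
isometry of `ℂ` onto that line fixing the real axis, so it is the identity or the conjugation
(`exists_eq_smul_or_eq_conj_smul`).
-/

/-! ### Holomorphic maps do not increase the Kobayashi metric and distance -/

section Contraction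

variable {E F : Type*} [NormedAddCommGroup E] [NormedSpace ℂ E]
  [NormedAddCommGroup F] [NormedSpace ℂ F]

theorem kobayashiRoyden_le_ofReal {Ω : Set E} {x v : E} {φ : ℂ → E}
    (hd : DifferentiableOn ℂ φ (Metric.ball 0 1)) (hm : MapsTo φ (Metric.ball 0 1) Ω)
    (h0 : φ 0 = x) {r : ℝ} (hr : 0 < r) (hv : (r : ℂ) • deriv φ 0 = v) :
    kobayashiRoyden Ω x v ≤ ENNReal.ofReal r :=
  iInf_le_of_le φ <| iInf_le_of_le hd <| iInf_le_of_le hm <| iInf_le_of_le h0 <|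
    iInf_le_of_le r <| iInf_le_of_le hr <| iInf_le_of_le hv le_rfl

theorem kobayashiRoyden_zero_right {Ω : Set E} {x : E} (hx : x ∈ Ω) :
    kobayashiRoyden Ω x 0 = 0 := by
  refine le_antisymm (ENNReal.le_of_forall_pos_le_add fun ε hε _ => ?_) bot_le
  have := kobayashiRoyden_le_ofReal (Ω := Ω) (x := x) (v := 0) (φ := fun _ => x)
    (by fun_prop) (fun _ _ => hx) rfl (r := ε) (by exact_mod_cast hε) (by simp)
  simpa using this

theorem kobayashiRoyden_map_le {U : Set E} {V : Set F} (hU : IsOpen U) {G : E → F}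
    (hG : DifferentiableOn ℂ G U) (hGm : MapsTo G U V) {x : E} (hx : x ∈ U) (v : E) :
    kobayashiRoyden V (G x) (fderiv ℂ G x v) ≤ kobayashiRoyden U x v := by
  refine le_iInf fun φ => le_iInf fun hd => le_iInf fun hm => le_iInf fun h0 =>
    le_iInf fun r => le_iInf fun hr => le_iInf fun hv => ?_
  refine kobayashiRoyden_le_ofReal (hG.comp hd hm) (hGm.comp hm) (by simp [h0]) hr ?_
  have h1 : HasDerivAt φ (deriv φ 0) 0 :=
    (hd.differentiableAt (Metric.ball_mem_nhds _ one_pos)).hasDerivAt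
  have h2 : HasFDerivAt G (fderiv ℂ G x) (φ 0) := by
    rw [h0]; exact (hG.differentiableAt (hU.mem_nhds hx)).hasFDerivAt
  rw [(h2.comp_hasDerivAt 0 h1).deriv, ← hv, map_smul]

theorem kobayashiDist_map_le {U : Set E} {V : Set F} (hU : IsOpen U) {G : E → F}
    (hG : ContDiffOn ℂ 1 G U) (hGm : MapsTo G U V) (x y : E) :
    kobayashiDist V (G x) (G y) ≤ kobayashiDist U x y := by
  refine le_iInf fun γ => le_iInf fun hγ => le_iInf fun hm => le_iInf fun h0 =>
    le_iInf fun h1 => ?_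
  refine iInf_le_of_le (G ∘ γ) <| iInf_le_of_le ((hG.restrict_scalars ℝ).comp hγ hm) <|
    iInf_le_of_le (hGm.comp hm) <| iInf_le_of_le (by simp [h0]) <|
    iInf_le_of_le (by simp [h1]) ?_
  refine setLIntegral_mono' measurableSet_Icc fun t ht => ?_
  have hγt : HasDerivWithinAt γ (derivWithin γ (Icc 0 1) t) (Icc 0 1) t :=
    (hγ.differentiableOn one_ne_zero t ht).hasDerivWithinAt
  have hGt : HasFDerivAt G (fderiv ℂ G (γ t)) (γ t) :=
    ((hG.differentiableOn one_ne_zero).differentiableAt (hU.mem_nhds (hm ht))).hasFDerivAt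
  have := ((hGt.restrictScalars ℝ).comp_hasDerivWithinAt t hγt).derivWithin
    (uniqueDiffOn_Icc zero_lt_one t ht)
  rw [this]
  exact kobayashiRoyden_map_le hU (hG.differentiableOn one_ne_zero) hGm (hm ht) _

end Contraction

/-! ### The involutive automorphisms of the ball -/

section Involution

variable {E : Type*} [NormedAddCommGroup E] [InnerProductSpace ℂ E]

/-- The holomorphic involution of the unit ball of a complex inner product space that exchanges
`a` and `0`. With `s = √(1 - ‖a‖²)` and `P`, `Q` the orthogonal projections onto `ℂ a` and its
complement, it is `x ↦ (a - P x - s Q x) / (1 - ⟪a, x⟫)`; since `1 - s = ‖a‖² / (1 + s)`, the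
numerator is written without `P` and `Q`, so that `a = 0` needs no separate treatment. -/
noncomputable def ballInvolution (a x : E) : E :=
  (1 - inner ℂ a x)⁻¹ • (a - ((√(1 - ‖a‖ ^ 2) : ℝ) : ℂ) • x
    - (inner ℂ a x / (1 + ((√(1 - ‖a‖ ^ 2) : ℝ) : ℂ))) • a)

theorem one_sub_inner_ne_zero {a x : E} (ha : ‖a‖ < 1) (hx : ‖x‖ < 1) :
    (1 : ℂ) - inner ℂ a x ≠ 0 := by
  intro h
  have h1 : (inner ℂ a x : ℂ) = 1 := (sub_eq_zero.1 h).symm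
  have h2 := norm_inner_le_norm (𝕜 := ℂ) a x
  rw [h1, norm_one] at h2
  nlinarith [norm_nonneg a, norm_nonneg x]

theorem inner_ballInvolution {a : E} (ha : ‖a‖ < 1) (x : E) :
    inner ℂ a (ballInvolution a x) =
      (1 - inner ℂ a x)⁻¹ * (1 - ((√(1 - ‖a‖ ^ 2) : ℝ) : ℂ) ^ 2 - inner ℂ a x) := by
  have hs0 := Real.sqrt_nonneg (1 - ‖a‖ ^ 2)
  have hs2 : √(1 - ‖a‖ ^ 2) ^ 2 = 1 - ‖a‖ ^ 2 :=
    Real.sq_sqrt (by nlinarith [norm_nonneg a])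
  simp only [ballInvolution, inner_smul_right, inner_sub_right, inner_self_eq_norm_sq_to_K]
  generalize √(1 - ‖a‖ ^ 2) = s at *
  have hA : ((‖a‖ : ℝ) : ℂ) ^ 2 = 1 - (s : ℂ) ^ 2 := by
    rw [← Complex.ofReal_pow, ← Complex.ofReal_pow, hs2]; simp
  have hne : (1 : ℂ) + s ≠ 0 := by
    exact_mod_cast (by positivity : (1 : ℝ) + s ≠ 0)
  simp only [Complex.coe_algebraMap, hA]
  congr 1
  field_simp
  ring

theorem one_sub_norm_sq_ballInvolution {a x : E} (ha : ‖a‖ < 1) (hx : ‖x‖ < 1) :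
    1 - ‖ballInvolution a x‖ ^ 2 =
      (1 - ‖a‖ ^ 2) * (1 - ‖x‖ ^ 2) / ‖(1 : ℂ) - inner ℂ a x‖ ^ 2 := by
  have hne := one_sub_inner_ne_zero ha hx
  have hs0 := Real.sqrt_nonneg (1 - ‖a‖ ^ 2)
  have hs2 : √(1 - ‖a‖ ^ 2) ^ 2 = 1 - ‖a‖ ^ 2 :=
    Real.sq_sqrt (by nlinarith [norm_nonneg a])
  have hpos : 0 < ‖(1 : ℂ) - inner ℂ a x‖ := norm_pos_iff.2 hne
  rw [ballInvolution, norm_smul, norm_inv, mul_pow]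
  generalize √(1 - ‖a‖ ^ 2) = s at *
  have key : ‖a - (s : ℂ) • x - (inner ℂ a x / (1 + (s : ℂ))) • a‖ ^ 2 =
      ‖(1 : ℂ) - inner ℂ a x‖ ^ 2 - s ^ 2 * (1 - ‖x‖ ^ 2) := by
    have e1 : a - (s : ℂ) • x - (inner ℂ a x / (1 + (s : ℂ))) • a =
        (1 - inner ℂ a x / (1 + (s : ℂ))) • a - (s : ℂ) • x := by module
    rw [e1, @norm_sub_sq ℂ, norm_smul, norm_smul, inner_smul_left, inner_smul_right, mul_pow,
      mul_pow]
    have hA : ‖a‖ ^ 2 = 1 - s ^ 2 := by linarith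
    rw [hA]
    generalize (inner ℂ a x : ℂ) = α
    have h1s : (1 : ℝ) + s ≠ 0 := by positivity
    have e2 : (1 : ℂ) - α / (1 + s) = ⟨1 - α.re / (1 + s), - (α.im / (1 + s))⟩ := by
      have : α / (1 + (s : ℂ)) = α / ((1 + s : ℝ) : ℂ) := by push_cast; rfl
      rw [this]
      apply Complex.ext <;>
        simp [Complex.div_ofReal_re, Complex.div_ofReal_im, -Complex.ofReal_add]
    rw [e2]
    simp only [← Complex.normSq_eq_norm_sq]
    simp [Complex.normSq_apply]
    field_simp
    ring
  rw [key, ← hs2]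
  field_simp
  ring

theorem norm_ballInvolution_lt_one {a x : E} (ha : ‖a‖ < 1) (hx : ‖x‖ < 1) :
    ‖ballInvolution a x‖ < 1 := by
  have h := one_sub_norm_sq_ballInvolution ha hx
  have h1 : 0 < ‖(1 : ℂ) - inner ℂ a x‖ := norm_pos_iff.2 (one_sub_inner_ne_zero ha hx)
  have h2 : 0 < 1 - ‖a‖ ^ 2 := by nlinarith [norm_nonneg a]
  have h3 : 0 < 1 - ‖x‖ ^ 2 := by nlinarith [norm_nonneg x]
  have : 0 < 1 - ‖ballInvolution a x‖ ^ 2 := by rw [h]; positivity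
  nlinarith [norm_nonneg (ballInvolution a x)]

theorem mapsTo_ballInvolution {a : E} (ha : ‖a‖ < 1) :
    MapsTo (ballInvolution a) (Metric.ball 0 1) (Metric.ball 0 1) := fun x hx => by
  simpa using norm_ballInvolution_lt_one ha (by simpa using hx)

theorem ballInvolution_ballInvolution {a x : E} (ha : ‖a‖ < 1) (hx : ‖x‖ < 1) :
    ballInvolution a (ballInvolution a x) = x := by
  have hne := one_sub_inner_ne_zero ha hx
  have hne2 := one_sub_inner_ne_zero ha (norm_ballInvolution_lt_one ha hx)
  rw [ballInvolution, inner_ballInvolution ha x]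
  rw [inner_ballInvolution ha x] at hne2
  have hs0 : 0 < √(1 - ‖a‖ ^ 2) := Real.sqrt_pos.2 (by nlinarith [norm_nonneg a])
  rw [ballInvolution]
  generalize √(1 - ‖a‖ ^ 2) = s at *
  generalize (inner ℂ a x : ℂ) = α at *
  have hs : (s : ℂ) ≠ 0 := by exact_mod_cast hs0.ne'
  have h1s : (1 : ℂ) + s ≠ 0 := by exact_mod_cast (by positivity : (1 : ℝ) + s ≠ 0)
  have hval : 1 - (1 - α)⁻¹ * (1 - (s : ℂ) ^ 2 - α) = s ^ 2 / (1 - α) := by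
    field_simp
    ring
  rw [hval]
  match_scalars <;> field_simp
  ring

theorem ballInvolution_self {a : E} (ha : ‖a‖ < 1) : ballInvolution a a = 0 := by
  have h := one_sub_norm_sq_ballInvolution ha ha
  have h2 : 0 < 1 - ‖a‖ ^ 2 := by nlinarith [norm_nonneg a]
  have : (1 : ℂ) - inner ℂ a a = ((1 - ‖a‖ ^ 2 : ℝ) : ℂ) := by
    rw [inner_self_eq_norm_sq_to_K]; push_cast; rfl
  rw [this, Complex.norm_real, Real.norm_of_nonneg h2.le, ← sq, div_self (by positivity)] at h
  simpa using h

theorem contDiffOn_ballInvolution {a : E} (ha : ‖a‖ < 1) :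
    ContDiffOn ℂ 1 (ballInvolution a) (Metric.ball 0 1) := by
  have hi : ContDiff ℂ 1 fun x : E => (inner ℂ a x : ℂ) := (innerSL ℂ a).contDiff
  refine ContDiffOn.smul (ContDiffOn.inv (contDiff_const.sub hi).contDiffOn fun x hx =>
    one_sub_inner_ne_zero ha (by simpa using hx)) ?_
  exact ((contDiff_const.sub (contDiff_const.smul contDiff_id)).sub
    ((hi.div_const _).smul contDiff_const)).contDiffOn

theorem kobayashiDist_ballInvolution {a x y : E} (ha : ‖a‖ < 1) (hx : ‖x‖ < 1) (hy : ‖y‖ < 1) :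
    kobayashiDist (Metric.ball 0 1) (ballInvolution a x) (ballInvolution a y) =
      kobayashiDist (Metric.ball 0 1) x y := by
  have key := kobayashiDist_map_le Metric.isOpen_ball (contDiffOn_ballInvolution ha)
    (mapsTo_ballInvolution ha)
  refine le_antisymm (key x y) ?_
  simpa only [ballInvolution_ballInvolution ha hx, ballInvolution_ballInvolution ha hy] using
    key (ballInvolution a x) (ballInvolution a y)

end Involution

/-! ### The Kobayashi distance of the ball -/

theorem ballInvolution_complex {a : ℂ} (ha : ‖a‖ < 1) (z : ℂ) :
    ballInvolution a z = (a - z) / (1 - conj a * z) := by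
  have hs0 := Real.sqrt_nonneg (1 - ‖a‖ ^ 2)
  have hs2 : √(1 - ‖a‖ ^ 2) ^ 2 = 1 - ‖a‖ ^ 2 :=
    Real.sq_sqrt (by nlinarith [norm_nonneg a])
  have hi : (inner ℂ a z : ℂ) = conj a * z := by rw [RCLike.inner_apply, mul_comm]
  rw [ballInvolution, hi, div_eq_inv_mul (a - z), smul_eq_mul, smul_eq_mul, smul_eq_mul]
  congr 1
  generalize √(1 - ‖a‖ ^ 2) = s at *
  have h1s : (1 : ℂ) + s ≠ 0 := by exact_mod_cast (by positivity : (1 : ℝ) + s ≠ 0)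
  have hA : conj a * a = 1 - (s : ℂ) ^ 2 := by
    rw [mul_comm, Complex.mul_conj, Complex.normSq_eq_norm_sq, ← Complex.ofReal_pow, hs2]
    push_cast; ring
  field_simp
  linear_combination (-z) * hA

theorem hasDerivAt_ballInvolution_complex {a z : ℂ} (ha : ‖a‖ < 1) (hz : ‖z‖ < 1) :
    HasDerivAt (ballInvolution a) (-((1 - ‖a‖ ^ 2 : ℝ) : ℂ) / (1 - conj a * z) ^ 2) z := by
  have hne : 1 - conj a * z ≠ 0 := by
    have := one_sub_inner_ne_zero ha hz
    rwa [RCLike.inner_apply, mul_comm] at this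
  rw [funext (ballInvolution_complex ha)]
  have h1 : HasDerivAt (fun z : ℂ => a - z) (-1) z := (hasDerivAt_id z).const_sub a
  have h2 : HasDerivAt (fun z : ℂ => 1 - conj a * z) (-(conj a * 1)) z :=
    ((hasDerivAt_id z).const_mul (conj a)).const_sub 1
  convert! h1.div h2 hne using 2
  have hA : conj a * a = (‖a‖ : ℂ) ^ 2 := by
    rw [mul_comm, Complex.mul_conj, Complex.normSq_eq_norm_sq]; push_cast; rfl
  push_cast
  linear_combination -hA

/-- The infinitesimal **Schwarz–Pick lemma** at the origin. -/
theorem norm_deriv_zero_le_of_mapsTo_unit_ball {ψ : ℂ → ℂ}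
    (hd : DifferentiableOn ℂ ψ (Metric.ball 0 1))
    (hm : MapsTo ψ (Metric.ball 0 1) (Metric.ball 0 1)) : ‖deriv ψ 0‖ ≤ 1 - ‖ψ 0‖ ^ 2 := by
  have ha : ‖ψ 0‖ < 1 := by simpa using hm (Metric.mem_ball_self one_pos)
  have hpos : 0 < 1 - ‖ψ 0‖ ^ 2 := by nlinarith [norm_nonneg (ψ 0)]
  have hd0 : HasDerivAt ψ (deriv ψ 0) 0 :=
    (hd.differentiableAt (Metric.ball_mem_nhds _ one_pos)).hasDerivAt
  have h1 := (hasDerivAt_ballInvolution_complex ha ha).comp 0 hd0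
  have h2 : ‖deriv (ballInvolution (ψ 0) ∘ ψ) 0‖ ≤ 1 := by
    refine Complex.norm_deriv_le_one_of_mapsTo_ball (R := 1)
      (((contDiffOn_ballInvolution ha).differentiableOn one_ne_zero).comp hd hm) ?_ one_pos
    rw [Function.comp_apply, ballInvolution_self ha]
    exact ((mapsTo_ballInvolution ha).comp hm).mono_right Metric.ball_subset_closedBall
  have hA : (1 : ℂ) - conj (ψ 0) * ψ 0 = ((1 - ‖ψ 0‖ ^ 2 : ℝ) : ℂ) := by
    rw [mul_comm, Complex.mul_conj, Complex.normSq_eq_norm_sq]; push_cast; rfl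
  rw [h1.deriv, hA, norm_mul, norm_div, norm_neg, norm_pow, Complex.norm_real,
    Real.norm_of_nonneg hpos.le] at h2
  field_simp at h2
  exact h2

theorem Real.hasDerivAt_artanh {x : ℝ} (hx : x ∈ Ioo (-1) 1) :
    HasDerivAt Real.artanh (1 / (1 - x ^ 2)) x := by
  have h1 : 0 < 1 + x := by linarith [hx.1]
  have h2 : 0 < 1 - x := by linarith [hx.2]
  have h3 : 1 - x ^ 2 ≠ 0 := by nlinarith
  have e : Real.artanh =ᶠ[nhds x] fun y => 1 / 2 * Real.log ((1 + y) / (1 - y)) := by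
    filter_upwards [isOpen_Ioo.mem_nhds hx] with y hy
    exact Real.artanh_eq_half_log (Ioo_subset_Icc_self hy)
  refine HasDerivAt.congr_of_eventuallyEq ?_ e
  have d1 : HasDerivAt (fun y : ℝ => 1 + y) 1 x := (hasDerivAt_id x).const_add 1
  have d2 : HasDerivAt (fun y : ℝ => 1 - y) (-1) x := (hasDerivAt_id x).const_sub 1
  convert! ((d1.div d2 h2.ne').log (div_pos h1 h2).ne').const_mul (1 / 2) using 1
  have : 1 - x ^ 2 = (1 - x) * (1 + x) := by ring
  rw [Pi.div_apply, this]
  field_simp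
  ring

/-- The fundamental theorem of calculus for `artanh ∘ c`, where `c` is a `C¹` path in
`(-1, 1)`. -/
theorem integral_div_one_sub_sq {c : ℝ → ℝ} (hc : ContDiffOn ℝ 1 c (Icc 0 1))
    (hm : MapsTo c (Icc 0 1) (Ioo (-1) 1)) :
    IntegrableOn (fun t => derivWithin c (Icc 0 1) t / (1 - c t ^ 2)) (Icc 0 1) ∧
      ∫ t in Icc (0 : ℝ) 1, derivWithin c (Icc 0 1) t / (1 - c t ^ 2) =
        Real.artanh (c 1) - Real.artanh (c 0) := by
  have hcont : ContinuousOn (fun t => derivWithin c (Icc 0 1) t / (1 - c t ^ 2)) (Icc 0 1) := by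
    refine (hc.continuousOn_derivWithin (uniqueDiffOn_Icc zero_lt_one) le_rfl).div
      (continuousOn_const.sub (hc.continuousOn.pow 2)) fun t ht => ?_
    have := hm ht
    nlinarith [this.1, this.2]
  refine ⟨hcont.integrableOn_Icc, ?_⟩
  rw [integral_Icc_eq_integral_Ioc, ← intervalIntegral.integral_of_le zero_le_one]
  refine intervalIntegral.integral_eq_sub_of_hasDerivAt_of_le (f := Real.artanh ∘ c) zero_le_one
    (fun t ht => ((Real.hasDerivAt_artanh (hm ht)).continuousAt.comp_continuousWithinAt
      (hc.continuousOn t ht))) (fun t ht => ?_)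
    (hcont.mono (by rw [uIcc_of_le zero_le_one])).intervalIntegrable
  have ht' := Ioo_subset_Icc_self ht
  have h1 : HasDerivAt c (derivWithin c (Icc 0 1) t) t :=
    ((hc.differentiableOn one_ne_zero t ht').hasDerivWithinAt).hasDerivAt (Icc_mem_nhds ht.1 ht.2)
  convert! (Real.hasDerivAt_artanh (hm ht')).comp t h1 using 1
  ring

section Distance

variable {E : Type*} [NormedAddCommGroup E] [InnerProductSpace ℂ E]

theorem abs_re_inner_lt_one {e x : E} (he : ‖e‖ = 1) (hx : ‖x‖ < 1) :
    |(inner ℂ e x : ℂ).re| < 1 :=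
  calc |(inner ℂ e x : ℂ).re| ≤ ‖(inner ℂ e x : ℂ)‖ := Complex.abs_re_le_norm _
    _ ≤ ‖e‖ * ‖x‖ := norm_inner_le_norm _ _
    _ < 1 := by rwa [he, one_mul]

/-- The orthogonal projection of the ball onto the complex line through the unit vector `e`,
followed by the real part, compares the Kobayashi–Royden metric of the ball with the hyperbolic
metric of the interval `(-1, 1)`. -/
theorem le_kobayashiRoyden_ball {e : E} (he : ‖e‖ = 1) (x v : E) :
    ENNReal.ofReal (|(inner ℂ e v : ℂ).re| / (1 - (inner ℂ e x : ℂ).re ^ 2)) ≤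
      kobayashiRoyden (Metric.ball 0 1) x v := by
  refine le_iInf fun φ => le_iInf fun hd => le_iInf fun hm => le_iInf fun h0 =>
    le_iInf fun r => le_iInf fun hr => le_iInf fun hv => ENNReal.ofReal_le_ofReal ?_
  have h0m : (0 : ℂ) ∈ Metric.ball (0 : ℂ) 1 := Metric.mem_ball_self one_pos
  have hx : ‖x‖ < 1 := by simpa [h0] using hm h0m
  have hψm : MapsTo (innerSL ℂ e ∘ φ) (Metric.ball 0 1) (Metric.ball 0 1) := fun z hz => by
    have h1 : ‖φ z‖ < 1 := by simpa using hm hz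
    have h2 := norm_inner_le_norm (𝕜 := ℂ) e (φ z)
    rw [he, one_mul] at h2
    simpa using h2.trans_lt h1
  have hd0 : HasDerivAt φ (deriv φ 0) 0 :=
    (hd.differentiableAt (Metric.ball_mem_nhds _ one_pos)).hasDerivAt
  have hψ := norm_deriv_zero_le_of_mapsTo_unit_ball
    ((innerSL ℂ e).differentiable.comp_differentiableOn hd) hψm
  rw [((innerSL ℂ e).hasFDerivAt.comp_hasDerivAt 0 hd0).deriv] at hψ
  simp only [Function.comp_apply, innerSL_apply_apply, h0] at hψ
  have hpos : 0 < 1 - (inner ℂ e x : ℂ).re ^ 2 := by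
    have := abs_lt.1 (abs_re_inner_lt_one he hx)
    nlinarith [this.1, this.2]
  rw [div_le_iff₀ hpos, ← hv, inner_smul_right, Complex.re_ofReal_mul, abs_mul, abs_of_pos hr]
  refine mul_le_mul_of_nonneg_left ?_ hr.le
  have h1 := Complex.abs_re_le_norm (inner ℂ e (deriv φ 0))
  have h2 : (inner ℂ e x : ℂ).re ^ 2 ≤ ‖(inner ℂ e x : ℂ)‖ ^ 2 := by
    rw [← sq_abs]
    exact pow_le_pow_left₀ (abs_nonneg _) (Complex.abs_re_le_norm _) 2
  linarith

/-- The upper bound is given by the Möbius disc `ζ ↦ ((s + ζ) / (1 + s ζ)) • e`, whose derivative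
at `0` is `(1 - s²) • e`. -/
theorem kobayashiRoyden_ball_radial_le {e : E} (he : ‖e‖ = 1) {s c : ℝ} (hs : |s| < 1)
    (hc : 0 < c) :
    kobayashiRoyden (Metric.ball 0 1) ((s : ℂ) • e) ((c : ℂ) • e) ≤
      ENNReal.ofReal (c / (1 - s ^ 2)) := by
  have hs' : ‖(-s : ℂ)‖ < 1 := by rwa [norm_neg, Complex.norm_real]
  have hpos : 0 < 1 - s ^ 2 := by
    have := abs_lt.1 hs
    nlinarith [this.1, this.2]
  have hder := hasDerivAt_ballInvolution_complex (z := 0) hs' (by simp)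
  refine kobayashiRoyden_le_ofReal (φ := fun ζ => (-ballInvolution (-s : ℂ) ζ) • e)
    (((contDiffOn_ballInvolution hs').differentiableOn one_ne_zero).neg.smul_const e)
    (fun ζ hζ => ?_) ?_ (div_pos hc hpos) ?_
  · have := norm_ballInvolution_lt_one hs' (by simpa using hζ : ‖ζ‖ < 1)
    simpa [norm_smul, he] using this
  · simp [ballInvolution_complex hs']
  · rw [(hder.fun_neg.smul_const e).deriv, smul_smul]
    congr 1
    have : (1 : ℂ) - (s : ℂ) ^ 2 ≠ 0 := by exact_mod_cast hpos.ne'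
    simp
    field_simp

theorem le_kobayashiDist_ball_zero (y : E) :
    ENNReal.ofReal (Real.artanh ‖y‖) ≤ kobayashiDist (Metric.ball 0 1) 0 y := by
  rcases eq_or_ne y 0 with rfl | hy
  · simp
  have hy' : (‖y‖ : ℂ) ≠ 0 := by simpa using hy
  refine le_iInf fun γ => le_iInf fun hγ => le_iInf fun hm => le_iInf fun h0 =>
    le_iInf fun h1 => ?_
  set e : E := (‖y‖⁻¹ : ℂ) • y with he_def
  have he : ‖e‖ = 1 := by rw [he_def, norm_smul]; simp [hy]
  let L : E →L[ℝ] ℝ := Complex.reCLM.comp ((innerSL ℂ e).restrictScalars ℝ)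
  have hL : ∀ x, L x = (inner ℂ e x : ℂ).re := fun x => by simp [L]
  have hLy : L y = ‖y‖ := by
    rw [hL, he_def, inner_smul_left, inner_self_eq_norm_sq_to_K]
    simp only [map_inv₀, Complex.conj_ofReal, Complex.coe_algebraMap]
    rw [sq, inv_mul_cancel_left₀ hy', Complex.ofReal_re]
  have hc : ContDiffOn ℝ 1 (L ∘ γ) (Icc 0 1) := L.contDiff.comp_contDiffOn hγ
  have hcm : MapsTo (L ∘ γ) (Icc 0 1) (Ioo (-1) 1) := fun t ht => by
    rw [Function.comp_apply, hL]
    exact abs_lt.1 (abs_re_inner_lt_one he (by simpa using hm ht))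
  have hI := (integral_div_one_sub_sq hc hcm).2
  simp only [Function.comp_apply, h0, h1, hLy, map_zero, Real.artanh_zero, sub_zero] at hI
  rw [← hI]
  refine (Real.ofReal_le_enorm _).trans ((enorm_integral_le_lintegral_enorm _).trans ?_)
  refine setLIntegral_mono' measurableSet_Icc fun t ht => ?_
  have hder : derivWithin (L ∘ γ) (Icc 0 1) t = L (derivWithin γ (Icc 0 1) t) :=
    (L.hasFDerivAt.comp_hasDerivWithinAt t
      (hγ.differentiableOn one_ne_zero t ht).hasDerivWithinAt).derivWithin
      (uniqueDiffOn_Icc zero_lt_one t ht)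
  have hct := hcm ht
  simp only [Function.comp_apply] at hct
  rw [hder, ← ofReal_norm, norm_div, Real.norm_eq_abs,
    Real.norm_of_nonneg (by nlinarith [hct.1, hct.2])]
  simp only [hL]
  exact le_kobayashiRoyden_ball he _ _

theorem kobayashiDist_ball_zero_le {y : E} (hy1 : ‖y‖ < 1) :
    kobayashiDist (Metric.ball 0 1) 0 y ≤ ENNReal.ofReal (Real.artanh ‖y‖) := by
  have hγ : ContDiff ℝ 1 fun t : ℝ => t • y := contDiff_id.smul contDiff_const
  have hderγ : ∀ t ∈ Icc (0 : ℝ) 1, derivWithin (fun t : ℝ => t • y) (Icc 0 1) t = y :=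
    fun t ht => by
      simpa using ((hasDerivAt_id t).smul_const y).hasDerivWithinAt.derivWithin
        (uniqueDiffOn_Icc zero_lt_one t ht)
  have hnorm : ∀ t ∈ Icc (0 : ℝ) 1, t * ‖y‖ < 1 := fun t ht => by
    nlinarith [ht.1, ht.2, norm_nonneg y]
  refine iInf_le_of_le (fun t => t • y) <| iInf_le_of_le hγ.contDiffOn <|
    iInf_le_of_le (fun t ht => ?_) <| iInf_le_of_le (by simp) <| iInf_le_of_le (by simp) ?_
  · rw [mem_ball_zero_iff, norm_smul, Real.norm_of_nonneg ht.1]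
    exact hnorm t ht
  have hc : ContDiffOn ℝ 1 (fun t : ℝ => t * ‖y‖) (Icc 0 1) :=
    (contDiff_id.mul contDiff_const).contDiffOn
  have hcm : MapsTo (fun t : ℝ => t * ‖y‖) (Icc 0 1) (Ioo (-1) 1) := fun t ht =>
    ⟨by nlinarith [mul_nonneg ht.1 (norm_nonneg y)], hnorm t ht⟩
  have hderc : ∀ t ∈ Icc (0 : ℝ) 1, derivWithin (fun t : ℝ => t * ‖y‖) (Icc 0 1) t = ‖y‖ :=
    fun t ht => by
      simpa using ((hasDerivAt_id t).mul_const ‖y‖).hasDerivWithinAt.derivWithin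
        (uniqueDiffOn_Icc zero_lt_one t ht)
  obtain ⟨hInt, hI⟩ := integral_div_one_sub_sq hc hcm
  simp only [one_mul, zero_mul, Real.artanh_zero, sub_zero] at hI
  rw [← hI, ofReal_integral_eq_lintegral_ofReal hInt]
  · refine setLIntegral_mono' measurableSet_Icc fun t ht => ?_
    rw [hderγ t ht, hderc t ht]
    rcases eq_or_ne y 0 with rfl | hy
    · rw [kobayashiRoyden_zero_right (by simp)]; exact bot_le
    have hy' : (‖y‖ : ℂ) ≠ 0 := by simpa using hy
    have he : ‖(‖y‖⁻¹ : ℂ) • y‖ = 1 := by rw [norm_smul]; simp [hy]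
    have hs : |t * ‖y‖| < 1 := abs_lt.2 (hcm ht)
    have := kobayashiRoyden_ball_radial_le he hs (norm_pos_iff.2 hy)
    rw [smul_smul, smul_smul, mul_inv_cancel₀ hy', one_smul, Complex.ofReal_mul,
      mul_inv_cancel_right₀ hy', Complex.coe_smul] at this
    exact this
  · refine (ae_restrict_iff' measurableSet_Icc).2 (Filter.Eventually.of_forall fun t ht => ?_)
    have := hcm ht
    simp only [Pi.zero_apply]
    rw [hderc t ht]
    exact div_nonneg (norm_nonneg y) (by nlinarith [this.1, this.2])

theorem kobayashiDist_ball {x y : E} (hx : ‖x‖ < 1) (hy : ‖y‖ < 1) :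
    kobayashiDist (Metric.ball 0 1) x y = ENNReal.ofReal (Real.artanh ‖ballInvolution x y‖) := by
  rw [← kobayashiDist_ballInvolution hx hx hy, ballInvolution_self hx]
  exact le_antisymm (kobayashiDist_ball_zero_le (norm_ballInvolution_lt_one hx hy))
    (le_kobayashiDist_ball_zero _)

end Distance

/-! ### Isometries of the disc into the ball -/

section Rigidity

variable {E : Type*} [NormedAddCommGroup E] [InnerProductSpace ℂ E]

/-- Equal Kobayashi distances have equal pseudo-hyperbolic invariants
`(1 - ‖x‖²)(1 - ‖y‖²) / |1 - ⟪x, y⟫|²`. -/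
theorem invariant_eq_of_kobayashiDist_eq {F : Type*} [NormedAddCommGroup F]
    [InnerProductSpace ℂ F] {x y : E} {z w : F} (hx : ‖x‖ < 1) (hy : ‖y‖ < 1) (hz : ‖z‖ < 1)
    (hw : ‖w‖ < 1)
    (h : kobayashiDist (Metric.ball 0 1) x y = kobayashiDist (Metric.ball 0 1) z w) :
    (1 - ‖x‖ ^ 2) * (1 - ‖y‖ ^ 2) / ‖(1 : ℂ) - inner ℂ x y‖ ^ 2 =
      (1 - ‖z‖ ^ 2) * (1 - ‖w‖ ^ 2) / ‖(1 : ℂ) - inner ℂ z w‖ ^ 2 := by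
  rw [kobayashiDist_ball hx hy, kobayashiDist_ball hz hw,
    ENNReal.ofReal_eq_ofReal_iff (Real.artanh_nonneg (norm_nonneg _))
      (Real.artanh_nonneg (norm_nonneg _))] at h
  have hxy := norm_ballInvolution_lt_one hx hy
  have hzw := norm_ballInvolution_lt_one hz hw
  have := Real.artanh_injOn ⟨by linarith [norm_nonneg (ballInvolution x y)], hxy⟩
    ⟨by linarith [norm_nonneg (ballInvolution z w)], hzw⟩ h
  rw [← one_sub_norm_sq_ballInvolution hx hy, ← one_sub_norm_sq_ballInvolution hz hw, this]

/-- The equality case of `|1 - u| ≤ 1 + r²` for `u = ⟪x, y⟫` and `‖x‖ = ‖y‖ = r`. -/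
theorem eq_neg_of_norm_one_sub_inner {x y : E} (hxy : ‖y‖ = ‖x‖)
    (h : ‖(1 : ℂ) - inner ℂ x y‖ = 1 + ‖x‖ ^ 2) : y = -x := by
  have h1 : ‖(inner ℂ x y : ℂ)‖ ≤ ‖x‖ ^ 2 := by
    simpa [hxy, sq] using norm_inner_le_norm (𝕜 := ℂ) x y
  have h2 : ‖(1 : ℂ) - inner ℂ x y‖ ^ 2 =
      1 - 2 * (inner ℂ x y : ℂ).re + ‖(inner ℂ x y : ℂ)‖ ^ 2 := by
    rw [← Complex.normSq_eq_norm_sq, ← Complex.normSq_eq_norm_sq]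
    simp [Complex.normSq_apply]
    ring
  have h3 : ‖y + x‖ ^ 2 = 2 * ‖x‖ ^ 2 + 2 * (inner ℂ x y : ℂ).re := by
    rw [add_comm, @norm_add_sq ℂ, hxy, RCLike.re_to_complex]
    ring
  rw [h] at h2
  have h4 : ‖y + x‖ ^ 2 ≤ 0 := by
    nlinarith [norm_nonneg (inner ℂ x y : ℂ), sq_nonneg ‖x‖]
  have h5 : y + x = 0 := by
    have := sq_nonneg ‖y + x‖
    simpa using le_antisymm h4 this
  exact eq_neg_of_add_eq_zero_left h5

/-- A map of the disc into the ball that fixes the origin and preserves the Kobayashi distance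
satisfies `hnorm` and `hinner`; these identities force it to be the restriction of a complex linear
or conjugate-linear map. -/
theorem exists_eq_smul_or_eq_conj_smul {G : ℂ → E} (hnorm : ∀ z, ‖z‖ < 1 → ‖G z‖ = ‖z‖)
    (hinner : ∀ z w, ‖z‖ < 1 → ‖w‖ < 1 →
      ‖(1 : ℂ) - inner ℂ (G z) (G w)‖ = ‖1 - conj z * w‖) :
    ∃ e : E, (∀ z, ‖z‖ < 1 → G z = z • e) ∨ (∀ z, ‖z‖ < 1 → G z = conj z • e) := by
  have hsq : ∀ u : ℂ, ‖1 - u‖ ^ 2 = 1 - 2 * u.re + ‖u‖ ^ 2 := fun u => by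
    rw [← Complex.normSq_eq_norm_sq, ← Complex.normSq_eq_norm_sq]
    simp [Complex.normSq_apply]
    ring
  have hneg : ∀ z, ‖z‖ < 1 → G (-z) = -G z := fun z hz => by
    refine eq_neg_of_norm_one_sub_inner
      (by rw [hnorm _ (by rwa [norm_neg]), hnorm z hz, norm_neg]) ?_
    have hA : (1 : ℂ) - conj z * -z = ((1 + ‖z‖ ^ 2 : ℝ) : ℂ) := by
      rw [mul_neg, mul_comm, Complex.mul_conj, Complex.normSq_eq_norm_sq]; push_cast; ring
    rw [hinner _ _ hz (by rwa [norm_neg]), hA, Complex.norm_real,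
      Real.norm_of_nonneg (by positivity), hnorm z hz]
  -- Comparing `|1 - u|` and `|1 + u|`, the latter coming from the point `-w`, determines both
  -- `|u|` and `Re u`.
  have hpair : ∀ z w, ‖z‖ < 1 → ‖w‖ < 1 → ‖(inner ℂ (G z) (G w) : ℂ)‖ = ‖z‖ * ‖w‖ ∧
      (inner ℂ (G z) (G w) : ℂ).re = (conj z * w).re := fun z w hz hw => by
    have h1 := congrArg (· ^ 2) (hinner z w hz hw)
    have h2 := congrArg (· ^ 2) (hinner z (-w) hz (by rwa [norm_neg]))
    simp only [hneg w hw, inner_neg_right, mul_neg, hsq, norm_neg, Complex.neg_re, norm_mul,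
      RCLike.norm_conj] at h1 h2
    refine ⟨?_, by linarith⟩
    rw [← sq_eq_sq₀ (norm_nonneg _) (by positivity)]
    linarith
  have hhalf : ‖(1 / 2 : ℂ)‖ < 1 := by norm_num
  set e : E := (2 : ℂ) • G (1 / 2) with he_def
  have he : ‖e‖ = 1 := by rw [he_def, norm_smul, hnorm _ hhalf]; norm_num
  have hee : (inner ℂ e e : ℂ) = 1 := by rw [inner_self_eq_norm_sq_to_K, he]; simp
  obtain ⟨c, hc⟩ : ∃ c : ℂ → ℂ, ∀ z, ‖z‖ < 1 → (c z).re = z.re ∧ G z = c z • e := by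
    refine ⟨fun z => inner ℂ e (G z), fun z hz => ?_⟩
    obtain ⟨h1, h2⟩ := hpair (1 / 2) z hhalf hz
    beta_reduce
    constructor
    · rw [he_def, inner_smul_left, map_ofNat]
      simp only [Complex.mul_re, Complex.re_ofNat, Complex.im_ofNat, zero_mul, sub_zero, h2]
      simp
    · have h3 : ‖(inner ℂ e (G z) : ℂ)‖ = ‖z‖ := by
        rw [he_def, inner_smul_left, norm_mul, h1]; norm_num; ring
      have he0 : e ≠ 0 := by rintro h; simp [h] at he
      have := ((norm_inner_eq_norm_tfae ℂ e (G z)).out 0 1).1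
        (by rw [h3, he, one_mul, hnorm z hz])
      rw [hee, div_one] at this
      exact this.resolve_left he0
  have hI : ‖(Complex.I / 2 : ℂ)‖ < 1 := by norm_num
  have him : ∀ z, ‖z‖ < 1 → (c z).im * (c (Complex.I / 2)).im = z.im / 2 := fun z hz => by
    have h1 := (hpair z (Complex.I / 2) hz hI).2
    obtain ⟨h2, h3⟩ := hc z hz
    obtain ⟨h4, h5⟩ := hc _ hI
    rw [h3, h5, inner_smul_left, inner_smul_right, hee] at h1
    simp [h4] at h1
    linarith
  -- At `I / 2` this fixes the sign of the imaginary part of `c`, and that sign is the same at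
  -- every other point.
  have hII : (c (Complex.I / 2)).im = 1 / 2 ∨ (c (Complex.I / 2)).im = -(1 / 2) := by
    have := him _ hI
    simp at this
    rw [← sq_eq_sq_iff_eq_or_eq_neg]
    linarith
  refine ⟨e, hII.imp (fun h z hz => ?_) fun h z hz => ?_⟩
  all_goals
    have h1 := him z hz
    obtain ⟨h2, h3⟩ := hc z hz
    rw [h] at h1
    rw [h3]
    congr 1
    apply Complex.ext
    · simp [h2]
    · try rw [Complex.conj_im]
      linarith

/-- A map of the disc into the ball that preserves the Kobayashi distance is the composition of
`z ↦ z • e` or `z ↦ conj z • e` with an automorphism of the ball. -/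
theorem exists_eq_ballInvolution_comp {g : ℂ → E}
    (hg : PreservesKobayashiDist g (Metric.ball 0 1) (Metric.ball 0 1)) :
    ∃ a e : E, ‖a‖ < 1 ∧ (∀ z : ℂ, ‖z‖ < 1 → ‖z • e‖ < 1) ∧
      ((∀ z, ‖z‖ < 1 → g z = ballInvolution a (z • e)) ∨
        (∀ z, ‖z‖ < 1 → g z = ballInvolution a (conj z • e))) := by
  obtain ⟨hm, hd⟩ := hg
  have hg1 : ∀ z, ‖z‖ < 1 → ‖g z‖ < 1 := fun z hz => by simpa using hm (by simpa using hz)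
  have h0 : ‖(0 : ℂ)‖ < 1 := by simp
  have ha := hg1 0 h0
  set G : ℂ → E := fun z => ballInvolution (g 0) (g z) with hG
  have hG1 : ∀ z, ‖z‖ < 1 → ‖G z‖ < 1 := fun z hz => norm_ballInvolution_lt_one ha (hg1 z hz)
  have hG0 : G 0 = 0 := ballInvolution_self ha
  have hinv : ∀ z w, ‖z‖ < 1 → ‖w‖ < 1 →
      (1 - ‖G z‖ ^ 2) * (1 - ‖G w‖ ^ 2) / ‖(1 : ℂ) - inner ℂ (G z) (G w)‖ ^ 2 =
        (1 - ‖z‖ ^ 2) * (1 - ‖w‖ ^ 2) / ‖(1 : ℂ) - inner ℂ z w‖ ^ 2 := fun z w hz hw =>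
    invariant_eq_of_kobayashiDist_eq (hG1 z hz) (hG1 w hw) hz hw <| by
      rw [hG, kobayashiDist_ballInvolution ha (hg1 z hz) (hg1 w hw)]
      exact hd z (by simpa using hz) w (by simpa using hw)
  have hnorm : ∀ z, ‖z‖ < 1 → ‖G z‖ = ‖z‖ := fun z hz => by
    have := hinv 0 z h0 hz
    rw [hG0] at this
    simpa [sq_eq_sq₀] using this
  have hinner : ∀ z w, ‖z‖ < 1 → ‖w‖ < 1 →
      ‖(1 : ℂ) - inner ℂ (G z) (G w)‖ = ‖1 - conj z * w‖ := fun z w hz hw => by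
    have h1 := hinv z w hz hw
    have hz' : 0 < 1 - ‖z‖ ^ 2 := by nlinarith [norm_nonneg z]
    have hw' : 0 < 1 - ‖w‖ ^ 2 := by nlinarith [norm_nonneg w]
    have h2 := norm_pos_iff.2 (one_sub_inner_ne_zero (hG1 z hz) (hG1 w hw))
    have h3 := norm_pos_iff.2 (one_sub_inner_ne_zero hz hw)
    rw [hnorm z hz, hnorm w hw, div_eq_div_iff (by positivity) (by positivity)] at h1
    have h4 := mul_left_cancel₀ (mul_pos hz' hw').ne' h1
    rw [RCLike.inner_apply, mul_comm w] at h4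
    exact ((sq_eq_sq₀ (norm_nonneg _) (norm_nonneg _)).1 h4).symm
  obtain ⟨e, he⟩ := exists_eq_smul_or_eq_conj_smul hnorm hinner
  have hgG : ∀ z, ‖z‖ < 1 → g z = ballInvolution (g 0) (G z) := fun z hz =>
    (ballInvolution_ballInvolution ha (hg1 z hz)).symm
  refine ⟨g 0, e, ha, fun z hz => ?_, he.imp (fun h z hz => by rw [hgG z hz, h z hz])
    fun h z hz => by rw [hgG z hz, h z hz]⟩
  rcases he with h | h
  · rw [← h z hz]; exact hG1 z hz
  · have hz' : ‖conj z‖ < 1 := by rwa [RCLike.norm_conj]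
    have := h _ hz'
    rw [Complex.conj_conj] at this
    rw [← this]; exact hG1 _ hz'

end Rigidity

theorem mainTheorem6 (n : ℕ) (Ω : Set (EuclideanSpace ℂ (Fin n)))
    (hΩ_open : IsOpen Ω) (hΩ_conn : IsConnected Ω)
    (h : ℂ → EuclideanSpace ℂ (Fin n)) (hh : IsIsometricHolomorphicDisc h Ω)
    (f : EuclideanSpace ℂ (Fin n) → EuclideanSpace ℂ (Fin n)) (hf_cont : ContinuousOn f Ω)
    (hf : PreservesKobayashiDist f Ω (Metric.ball 0 1)) :
    DifferentiableOn ℂ (f ∘ h) (Metric.ball 0 1) ∨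
      ConjHolomorphicOn (f ∘ h) (Metric.ball 0 1) := by
  have hg : PreservesKobayashiDist (f ∘ h) (Metric.ball 0 1) (Metric.ball 0 1) :=
    ⟨hf.1.comp hh.2.1, fun z hz w hw =>
      (hf.2 _ (hh.2.1 hz) _ (hh.2.1 hw)).trans (hh.2.2 z hz w hw)⟩
  obtain ⟨a, e, ha, he, hge⟩ := exists_eq_ballInvolution_comp hg
  have hF : DifferentiableOn ℂ (fun z : ℂ => ballInvolution a (z • e)) (Metric.ball 0 1) :=
    ((contDiffOn_ballInvolution ha).differentiableOn one_ne_zero).comp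
      (differentiable_id.smul_const e).differentiableOn
      fun z hz => by simpa using he z (by simpa using hz)
  refine hge.imp (fun hlin => hF.congr fun z hz => hlin z (by simpa using hz))
    fun hconj i z hz => ?_
  have hz' : conj z ∈ Metric.ball (0 : ℂ) 1 := by simpa using hz
  have hFi : DifferentiableAt ℂ (fun z : ℂ => ballInvolution a (z • e) i) (conj z) :=
    ((differentiableOn_euclidean.1 hF i).differentiableAt (Metric.isOpen_ball.mem_nhds hz'))
  refine DifferentiableAt.differentiableWithinAt ?_
  have hF' := hFi.conj_conj
  rw [Complex.conj_conj] at hF'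
  refine hF'.congr_of_eventuallyEq ?_
  filter_upwards [Metric.isOpen_ball.mem_nhds hz] with w hw
  simp only [Function.comp_apply]
  rw [← hconj w (by simpa using hw)]
  rfl
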